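/- Let $d\in\{2,3\}$, let $\Omega\subset\mathbb R^d$ be a bounded Lipschitz domain with boundary $\Gamma$, let $\Gamma_0\subset\Gamma$ be relatively open, with positive $(d-1)$-dimensional measure equal to that of $\overline{\Gamma_0}$, and put $\Gamma_1=\Gamma\setminus\overline{\Gamma_0}$. Let $\mathcal T_h$ be a (finite, conforming) triangulation by closed $d$-simplices $K$ with $\Omega=\operatorname{int}\bigl(\bigcup_{K\in\mathcal T_h}K\bigr)$. Let $C=(c_{ijkl})$, $c_{ijkl}=\lambda\delta_{ij}\delta_{kl}+\mu(\delta_{ik}\delta_{jl}+\delta_{il}\delta_{jk})$ with $\lambda,\mu\in\mathbb R$, be positive: for some $c_*>0$, $\sum_{i,j,k,l} c_{ijkl}\xi_{ij}\xi_{kl}\ge c_*|\xi|^2$ for all symmetric $\xi\in\mathbb R^{d\times d}$. Let $\eta>0$, $\alpha\ge0$, $T>0$, $\tau>0$, $N_T=\lfloor T/\tau\rfloor$, $t^k=k\tau$. Let $f\in C([0,T];L^2(\Omega;\mathbb R^d))$ and $q\in C([0,T];L^2(\Gamma_1;\mathbb R^d))$ satisfy $\partial f/\partial t=0$ and $\partial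 q/\partial t=0$ in $(0,T)$, and put $\ell^k(v)=\int_\Omega f(t^k)\cdot v\,dx+\int_{\Gamma_1}q(t^k)\cdot v\,ds$; since the data do not depend on time, $\ell^k=\ell^0=:\ell$. Write $e[u]=\tfrac12(\nabla u+(\nabla u)^T)$, $\sigma[u,\phi]=C(e[u]-\phi)$, $(\phi,\psi)_\Psi=\int_\Omega\sum_{i,j}\phi_{ij}\psi_{ij}\,dx$, $\|\psi\|_\Psi^2=(\psi,\psi)_\Psi$, $\|\psi\|_C^2=(C\psi,\psi)_\Psi$, and $\overline D_\tau\rho^k=(\rho^k-\rho^{k-1})/\tau$. Let $X_h$ be the space of functions in $C(\overline\Omega;\mathbb R^d)$ that are affine on each $K\in\mathcal T_h$, let $\Psi_h$ be the space of functions in $L^2(\Omega;\mathbb R^{d\times d}_{\rm sym})$ that are constant on each $K\in\mathcal T_h$, and for $g\in X_h$ let $V_h(g)=\{v\in X_h:\ v|_{\Gamma_0}=g|_{\Gamma_0}\}$, $V_h=V_h(0)$. Let $g_h\in X_h$ (independent of $k$) and $\phi_h^0\in\Psi_h$ be given, and let $(u_h^k,\phi_h^k)\in V_h(g_h)\times\Psi_h$,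 $k=0,\dots,N_T$, with the given $\phi_h^0$, solve the scheme $$(\sigma[u_h^k,\phi_h^k],e[v_h])_\Psi=\ell^k(v_h)\quad\forall v_h\in V_h,\ k=0,\dots,N_T,$$ $$\eta\overline D_\tau\phi_h^k+\alpha\phi_h^k-\sigma[u_h^k,\phi_h^k]=0\quad\text{in }\Psi_h,\ k=1,\dots,N_T.$$ Define $E(u,\phi)=\tfrac12\|e[u]-\phi\|_C^2+\tfrac\alpha2\|\phi\|_\Psi^2-\ell(u)$, $E_h^k=E(u_h^k,\phi_h^k)$, and, for $\phi_h,\psi_h\in\Psi_h$, $E_{h*}(\psi_h)=\min_{v_h\in V_h(g_h)}E(v_h,\psi_h)$ and $\partial E_{h*}(\phi_h)[\psi_h]=\frac{d}{d\varepsilon}E_{h*}(\phi_h+\varepsilon\psi_h)|_{\varepsilon=0}$. Then the minimum defining $E_{h*}(\psi_h)$ is attained for every $\psi_h\in\Psi_h$, and for every $k=1,\dots,N_T$: (i) (gradient flow structure) for every $\psi_h\in\Psi_h$ the derivative $\partial E_{h*}(\phi_h^k)[\psi_h]$ exists and $$(\eta\overline D_\tau\phi_h^k,\psi_h)_\Psi=-\partial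 E_{h*}(\phi_h^k)[\psi_h];$$ (ii) (energy identity) $$\overline D_\tau E_h^k+\frac{\alpha\tau}2\|\overline D_\tau\phi_h^k\|_\Psi^2+\frac\tau2\|\overline D_\tau(e[u_h^k]-\phi_h^k)\|_C^2=-\eta\|\overline D_\tau\phi_h^k\|_\Psi^2\le0;$$ (iii) (energy decay) $E_h^k\le E_h^{k-1}$. -/

import Mathlib

open MeasureTheory Set

noncomputable section

namespace MaxwellFEM

/-- Points and vectors of `ℝ^d`, with the Euclidean norm. -/
abbrev Vec (d : ℕ) : Type := EuclideanSpace ℝ (Fin d)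

/-- Real `d × d` matrices. -/
abbrev Mat (d : ℕ) : Type := Matrix (Fin d) (Fin d) ℝ

variable {d : ℕ}

/-! ### Geometry -/

/-- Near each boundary point, `Ω` is the strict epigraph of a Lipschitz function `γ` of the
coordinates orthogonal to some unit direction `ν`. -/
def HasLipschitzBoundary (Ω : Set (Vec d)) : Prop :=
  ∀ x ∈ frontier Ω, ∃ (ν : Vec d) (K : NNReal) (γ : Vec d → ℝ) (U : Set (Vec d)),
    ‖ν‖ = 1 ∧ LipschitzWith K γ ∧ IsOpen U ∧ x ∈ U ∧
      ∀ y ∈ U, (y ∈ Ω ↔ γ (y - inner ℝ ν y • ν) < inner ℝ ν y)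

/-- Bounded Lipschitz domain. -/
structure IsBoundedLipschitzDomain (Ω : Set (Vec d)) : Prop where
  isOpen : IsOpen Ω
  isConnected : IsConnected Ω
  isBounded : Bornology.IsBounded Ω
  lipschitz : HasLipschitzBoundary Ω

/-- The `(d-1)`-dimensional surface measure `ds`: Hausdorff measure, normalised to agree with
Lebesgue measure on hyperplanes. -/
def surfaceMeasure (d : ℕ) : Measure (Vec d) := Measure.euclideanHausdorffMeasure (d - 1)

/-- The Neumann part `Γ₁ = Γ \ closure Γ₀` of the boundary `Γ = ∂Ω`. -/
def neumannPart (Ω Γ₀ : Set (Vec d)) : Set (Vec d) := frontier Ω \ closure Γ₀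

/-- `Γ₀` is a relatively open part of `∂Ω` whose surface measure is positive and equal to that of
its closure. -/
structure IsDirichletPart (Ω Γ₀ : Set (Vec d)) : Prop where
  relOpen : ∃ U : Set (Vec d), IsOpen U ∧ Γ₀ = U ∩ frontier Ω
  measure_pos : 0 < surfaceMeasure d Γ₀
  measure_closure : surfaceMeasure d (closure Γ₀) = surfaceMeasure d Γ₀

/-- The closed simplex with vertex set `s`. -/
def simplex (s : Finset (Vec d)) : Set (Vec d) := convexHull ℝ (s : Set (Vec d))

/-- `T` (a finite set of vertex sets of `d`-simplices) is a conforming triangulation of `Ω`: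
two simplices meet in the simplex spanned by their common vertices, and `Ω` is the interior of
the union of the simplices. -/
structure IsTriangulation (T : Finset (Finset (Vec d))) (Ω : Set (Vec d)) : Prop where
  card_eq : ∀ s ∈ T, s.card = d + 1
  affineIndependent : ∀ s ∈ T, AffineIndependent ℝ (fun p : s => (p : Vec d))
  conforming : ∀ s ∈ T, ∀ t ∈ T,
    simplex s ∩ simplex t = convexHull ℝ ((s : Set (Vec d)) ∩ (t : Set (Vec d)))
  eq_interior : Ω = interior (⋃ s ∈ T, simplex s)

/-! ### Finite element spaces -/

/-- `X_h`: continuous on the closure of `Ω`, and affine on every simplex. -/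
def Xh (T : Finset (Finset (Vec d))) (Ω : Set (Vec d)) : Set (Vec d → Vec d) :=
  {v | ContinuousOn v (closure Ω) ∧
    ∀ s ∈ T, ∃ A : Vec d →ᵃ[ℝ] Vec d, EqOn v A (simplex s)}

/-- `Ψ_h`: on every simplex (almost everywhere) equal to a constant symmetric matrix. -/
def Psih (T : Finset (Finset (Vec d))) : Set (Vec d → Mat d) :=
  {ψ | ∀ s ∈ T, ∃ A : Mat d, A.IsSymm ∧ ∀ᵐ x ∂(volume.restrict (simplex s)), ψ x = A}

/-- `V_h(g)`: the elements of `X_h` with the same trace as `g` on `Γ₀`. The trace of a function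
that is continuous on the closure of `Ω` is its restriction, up to null sets of the surface
measure. -/
def Vh (T : Finset (Finset (Vec d))) (Ω Γ₀ : Set (Vec d)) (g : Vec d → Vec d) :
    Set (Vec d → Vec d) :=
  {v | v ∈ Xh T Ω ∧ ∀ᵐ x ∂((surfaceMeasure d).restrict Γ₀), v x = g x}

/-! ### Strain, stress, inner products -/

/-- The entries `∂u_i/∂x_j` of `∇u`. For a piecewise affine `u` this is, in the interior of
each simplex and hence almost everywhere, the weak gradient. -/
def grad (u : Vec d → Vec d) (x : Vec d) : Mat d :=
  Matrix.of fun i j => (fderiv ℝ u x (EuclideanSpace.single j (1 : ℝ))) i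

/-- The strain `e[u] = (∇u + (∇u)ᵀ) / 2`. -/
def strain (u : Vec d → Vec d) (x : Vec d) : Mat d :=
  (1 / 2 : ℝ) • (grad u x + (grad u x).transpose)

/-- Kronecker's delta. -/
def delta (i j : Fin d) : ℝ := if i = j then 1 else 0

/-- The isotropic elasticity tensor
`c_{ijkl} = lam δ_{ij} δ_{kl} + mu (δ_{ik} δ_{jl} + δ_{il} δ_{jk})`. -/
def elast (lam mu : ℝ) (i j k l : Fin d) : ℝ :=
  lam * (delta i j * delta k l) + mu * (delta i k * delta j l + delta i l * delta j k)

/-- `(C A)_{ij} = ∑_{k,l} c_{ijkl} A_{kl}`. -/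
def applyC (lam mu : ℝ) (A : Mat d) : Mat d :=
  Matrix.of fun i j => ∑ k, ∑ l, elast lam mu i j k l * A k l

/-- Positivity of the elasticity tensor on symmetric matrices. -/
def TensorPositive (d : ℕ) (lam mu : ℝ) : Prop :=
  ∃ c : ℝ, 0 < c ∧ ∀ ξ : Mat d, ξ.IsSymm →
    c * (∑ i, ∑ j, ξ i j ^ 2) ≤ ∑ i, ∑ j, ∑ k, ∑ l, elast lam mu i j k l * ξ i j * ξ k l

/-- `A : B = ∑_{i,j} A_{ij} B_{ij}`. -/
def ddot (A B : Mat d) : ℝ := ∑ i, ∑ j, A i j * B i j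

/-- The stress `σ[u, φ] = C (e[u] - φ)`. -/
def stress (lam mu : ℝ) (u : Vec d → Vec d) (φ : Vec d → Mat d) (x : Vec d) : Mat d :=
  applyC lam mu (strain u x - φ x)

/-- `(φ, ψ)_Ψ = ∫_Ω φ : ψ dx`. -/
def innerPsi (Ω : Set (Vec d)) (φ ψ : Vec d → Mat d) : ℝ := ∫ x in Ω, ddot (φ x) (ψ x)

/-- `(φ, ψ)_C = (C φ, ψ)_Ψ`. -/
def innerC (lam mu : ℝ) (Ω : Set (Vec d)) (φ ψ : Vec d → Mat d) : ℝ :=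
  innerPsi Ω (fun x => applyC lam mu (φ x)) ψ

/-- `‖ψ‖_Ψ`. -/
def normPsi (Ω : Set (Vec d)) (ψ : Vec d → Mat d) : ℝ := Real.sqrt (innerPsi Ω ψ ψ)

/-- `‖ψ‖_C`. -/
def normC (lam mu : ℝ) (Ω : Set (Vec d)) (ψ : Vec d → Mat d) : ℝ :=
  Real.sqrt (innerC lam mu Ω ψ ψ)

/-! ### Data, energy, scheme -/

/-- `L²(Ω; ℝ^d)`. -/
abbrev L2vol (Ω : Set (Vec d)) : Type := Lp (Vec d) 2 (volume.restrict Ω)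

/-- `L²(Γ₁; ℝ^d)` with respect to the surface measure. -/
abbrev L2surf (Γ₁ : Set (Vec d)) : Type := Lp (Vec d) 2 ((surfaceMeasure d).restrict Γ₁)

/-- The load `ℓ(v) = ∫_Ω f · v dx + ∫_{Γ₁} q · v ds`. -/
def load {Ω Γ₁ : Set (Vec d)} (f : L2vol Ω) (q : L2surf Γ₁) (v : Vec d → Vec d) : ℝ :=
  (∫ x in Ω, inner ℝ (f x) (v x)) + ∫ x in Γ₁, inner ℝ (q x) (v x) ∂(surfaceMeasure d)

/-- The energy `E(u, φ) = ‖e[u] - φ‖_C² / 2 + (alpha / 2) ‖φ‖_Ψ² - ℓ(u)`. -/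
def energy (lam mu alpha : ℝ) (Ω : Set (Vec d)) (ℓ : (Vec d → Vec d) → ℝ)
    (u : Vec d → Vec d) (φ : Vec d → Mat d) : ℝ :=
  1 / 2 * normC lam mu Ω (fun x => strain u x - φ x) ^ 2
    + alpha / 2 * normPsi Ω φ ^ 2 - ℓ u

/-- The set of values `E(v, ψ)`, where `v` ranges over `V`. -/
def energyValues (lam mu alpha : ℝ) (Ω : Set (Vec d)) (ℓ : (Vec d → Vec d) → ℝ)
    (V : Set (Vec d → Vec d)) (ψ : Vec d → Mat d) : Set ℝ :=
  (fun v => energy lam mu alpha Ω ℓ v ψ) '' V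

/-- The reduced energy: the minimum of `E(v, ψ)` over `v ∈ V`, written as an infimum. -/
def reducedEnergy (lam mu alpha : ℝ) (Ω : Set (Vec d)) (ℓ : (Vec d → Vec d) → ℝ)
    (V : Set (Vec d → Vec d)) (ψ : Vec d → Mat d) : ℝ :=
  sInf (energyValues lam mu alpha Ω ℓ V ψ)

/-- The functional `F` is differentiable at `φ` in the direction `ψ`. -/
def GateauxDifferentiableAt (F : (Vec d → Mat d) → ℝ) (φ ψ : Vec d → Mat d) : Prop :=
  DifferentiableAt ℝ (fun ε : ℝ => F (φ + ε • ψ)) 0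

/-- `∂F(φ)[ψ] = d/dε F(φ + ε ψ)` at `ε = 0`. -/
def gateaux (F : (Vec d → Mat d) → ℝ) (φ ψ : Vec d → Mat d) : ℝ :=
  deriv (fun ε : ℝ => F (φ + ε • ψ)) 0

/-- The backward difference `(ρ^k - ρ^{k-1}) / τ`, used for `k ≥ 1`. -/
def bdiff {M : Type*} [AddCommGroup M] [Module ℝ M] (τ : ℝ) (ρ : ℕ → M) (k : ℕ) : M :=
  τ⁻¹ • (ρ k - ρ (k - 1))

/-- `(u^k, φ^k)`, `k = 0, …, N`, solves the P1/P0 scheme with boundary data `g k`, loads `ℓ k`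
and initial value `φ0`. -/
structure IsSchemeSolution (lam mu alpha eta τ : ℝ) (N : ℕ) (T : Finset (Finset (Vec d)))
    (Ω Γ₀ : Set (Vec d)) (ℓ : ℕ → (Vec d → Vec d) → ℝ) (g : ℕ → Vec d → Vec d)
    (φ0 : Vec d → Mat d) (u : ℕ → Vec d → Vec d) (φ : ℕ → Vec d → Mat d) : Prop where
  mem_V : ∀ k ≤ N, u k ∈ Vh T Ω Γ₀ (g k)
  mem_Psi : ∀ k ≤ N, φ k ∈ Psih T
  init : ∀ᵐ x ∂(volume.restrict Ω), φ 0 x = φ0 x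
  balance : ∀ k ≤ N, ∀ v ∈ Vh T Ω Γ₀ 0,
    innerPsi Ω (stress lam mu (u k) (φ k)) (strain v) = ℓ k v
  evolution : ∀ k, 1 ≤ k → k ≤ N → ∀ᵐ x ∂(volume.restrict Ω),
    eta • bdiff τ φ k x + alpha • φ k x - stress lam mu (u k) (φ k) x = 0

end MaxwellFEM

end

open MaxwellFEM

namespace MaxwellFEM

open Filter Topology

variable {d : ℕ}

/-! For a fixed internal variable the energy is a quadratic functional of the displacement with
positive semidefinite quadratic part, so the discrete balance of forces, its Euler equation, already
implies minimality (`isLeast_energyValues_of_balance`). If `φ` moves to `φ + ε ψ`, the minimiser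
moves to `u + ε z`, where the strain of `z` is the `C`-orthogonal projection of `ψ` onto the strains
of `V_h` (`exists_strain_projection`). The reduced energy is therefore exactly a quadratic
polynomial in `ε`, with linear coefficient `α (φ, ψ) - (σ, ψ)` (`hasDerivAt_reducedEnergy`); the
evolution equation tested with `ψ` turns this into the gradient flow. Moving from `φ^0` to an
arbitrary `ψ` shows that the minimum is attained, so neither Korn's inequality nor coercivity
enters.

The energy identity is the binomial formula for both quadratic terms, with the balance tested by
`u^k - u^{k-1}` and the evolution equation by `φ^k - φ^{k-1}` (`energy_sub_energy`). Decay follows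
since the dissipated terms are nonnegative.

Fields here are functions, with equations holding almost everywhere; `innerPsiForm`, `innerCForm`
and `strainXh` reduce them to linear algebra. Linearity of the load requires integrability on the
boundary, hence finite surface measure. -/

/-! ### Finiteness of the surface measure of the boundary -/

/-- The graph of a Lipschitz function over the hyperplane `ν⊥`, with values in the direction `ν`,
is Lipschitz. -/
theorem lipschitzWith_graph {ν : Vec d} (hν : ‖ν‖ = 1) {K : NNReal} {γ : Vec d → ℝ}
    (hγ : LipschitzWith K γ) :
    LipschitzWith (1 + K) (fun w : (Submodule.span ℝ {ν})ᗮ => (w : Vec d) + γ w • ν) := by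
  refine LipschitzWith.of_dist_le_mul fun w w' => ?_
  calc dist ((w : Vec d) + γ w • ν) ((w' : Vec d) + γ w' • ν)
      ≤ dist (w : Vec d) w' + dist (γ w • ν) (γ w' • ν) := dist_add_add_le _ _ _ _
    _ = dist w w' + dist (γ w) (γ w') := by
        rw [dist_eq_norm (γ w • ν), ← sub_smul, norm_smul, hν, mul_one, ← dist_eq_norm]; rfl
    _ ≤ dist w w' + K * dist w w' := by
        gcongr
        exact hγ.dist_le_mul _ _
    _ = ↑(1 + K) * dist w w' := by push_cast; ring

/-- A boundary point in the domain of a chart lies on the graph. -/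
theorem eq_of_mem_frontier_of_epigraph {Ω U : Set (Vec d)} (hΩ : IsOpen Ω) (hU : IsOpen U)
    {ν : Vec d} {γ : Vec d → ℝ} (hγ : Continuous γ)
    (h : ∀ y ∈ U, (y ∈ Ω ↔ γ (y - inner ℝ ν y • ν) < inner ℝ ν y))
    {y : Vec d} (hy : y ∈ frontier Ω) (hyU : y ∈ U) :
    γ (y - inner ℝ ν y • ν) = inner ℝ ν y := by
  rw [hΩ.frontier_eq] at hy
  refine le_antisymm ?_ (not_lt.1 fun hlt => hy.2 ((h y hyU).2 hlt))
  by_contra! hlt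
  -- A point strictly below the graph has a neighbourhood below it, which misses `Ω`; so it is not
  -- in the closure of `Ω`.
  have hopen : IsOpen (U ∩ {z : Vec d | inner ℝ ν z < γ (z - inner ℝ ν z • ν)}) :=
    hU.inter (isOpen_lt (by fun_prop) (by fun_prop))
  obtain ⟨z, hz, hzΩ⟩ := mem_closure_iff.1 hy.1 _ hopen ⟨hyU, hlt⟩
  exact lt_asymm ((h z hz.1).1 hzΩ) hz.2

/-- The boundary of a bounded Lipschitz domain has finite surface measure. -/
theorem surfaceMeasure_frontier_lt_top {d : ℕ} (hd : 1 ≤ d) {Ω : Set (Vec d)}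
    (hΩ : IsBoundedLipschitzDomain Ω) : surfaceMeasure d (frontier Ω) < ⊤ := by
  have hcomp : IsCompact (frontier Ω) :=
    hΩ.isBounded.isCompact_closure.of_isClosed_subset isClosed_frontier frontier_subset_closure
  -- By compactness it suffices to bound the measure locally, by that of a Lipschitz image of a ball
  -- in the hyperplane `ν⊥`.
  refine hcomp.measure_lt_top_of_nhdsWithin fun x hx => ?_
  obtain ⟨ν, K, γ, U, hν, hγ, hU, hxU, h⟩ := hΩ.lipschitz x hx
  refine ⟨frontier Ω ∩ (U ∩ Metric.ball x 1), ?_, ?_⟩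
  · exact inter_mem self_mem_nhdsWithin
      (mem_nhdsWithin_of_mem_nhds
        (inter_mem (hU.mem_nhds hxU) (Metric.ball_mem_nhds x one_pos)))
  set W := (Submodule.span ℝ {ν})ᗮ
  have hW : Module.finrank ℝ W = d - 1 := by
    have : Fact (Module.finrank ℝ (Vec d) = (d - 1) + 1) := ⟨by simp; omega⟩
    exact Submodule.finrank_orthogonal_span_singleton (by rintro rfl; simp at hν)
  set F : W → Vec d := fun w => (w : Vec d) + γ w • ν
  have hF : LipschitzWith (1 + K) F := lipschitzWith_graph hν hγ
  -- Points of the unit ball about `x` have norm at most `‖x‖ + 1`, and removing the `ν`-component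
  -- at most doubles this crude bound.
  set R : ℝ := 2 * (‖x‖ + 1)
  have hsub : frontier Ω ∩ (U ∩ Metric.ball x 1) ⊆ F '' Metric.closedBall 0 R := by
    rintro y ⟨hy, hyU, hyx⟩
    have hyn : ‖y‖ ≤ ‖x‖ + 1 := by
      have h1 : ‖y - x‖ < 1 := by simpa [dist_eq_norm] using hyx
      have h2 : ‖y‖ ≤ ‖x‖ + ‖y - x‖ := by
        simpa using norm_add_le x (y - x)
      linarith
    have hmem : y - inner ℝ ν y • ν ∈ W := by
      rw [Submodule.mem_orthogonal_singleton_iff_inner_right, inner_sub_right, inner_smul_right,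
        real_inner_self_eq_norm_sq, hν]
      ring
    refine ⟨⟨_, hmem⟩, ?_, ?_⟩
    · have h1 : ‖y - inner ℝ ν y • ν‖ ≤ ‖y‖ + ‖y‖ := by
        refine (norm_sub_le _ _).trans ?_
        rw [norm_smul, hν, mul_one]
        have := norm_inner_le_norm (𝕜 := ℝ) ν y
        rw [hν, one_mul] at this
        linarith
      rw [mem_closedBall_zero_iff]
      change ‖y - inner ℝ ν y • ν‖ ≤ R
      linarith
    · change (y - inner ℝ ν y • ν) + γ (y - inner ℝ ν y • ν) • ν = y
      rw [eq_of_mem_frontier_of_epigraph hΩ.isOpen hU hγ.continuous h hy hyU]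
      abel
  refine (measure_mono hsub).trans_lt ?_
  rw [surfaceMeasure, Measure.euclideanHausdorffMeasure_def, Measure.smul_apply]
  refine ENNReal.mul_lt_top ENNReal.coe_lt_top ?_
  refine (hF.hausdorffMeasure_image_le (by positivity) _).trans_lt ?_
  refine ENNReal.mul_lt_top (ENNReal.rpow_lt_top_of_nonneg (by positivity) ENNReal.coe_ne_top) ?_
  -- With exponent equal to the dimension of `W`, the Hausdorff measure on `W` is a Haar measure,
  -- hence finite on compact sets.
  rw [← hW]
  exact (isCompact_closedBall (0 : W) R).measure_lt_top

/-! ### Linearity of the load -/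

/-- A continuous function on the compact closure is bounded, hence square integrable for a finite
measure, and the product of two `L²` functions is integrable. -/
theorem integrable_inner_of_continuousOn {Ω s : Set (Vec d)} (hΩ : Bornology.IsBounded Ω)
    {m : Measure (Vec d)} (hs : MeasurableSet s) (hsub : s ⊆ closure Ω) (hm : m s < ⊤)
    (f : Lp (Vec d) 2 (m.restrict s)) {v : Vec d → Vec d} (hv : ContinuousOn v (closure Ω)) :
    IntegrableOn (fun x => inner ℝ (f x) (v x)) s m := by
  have : IsFiniteMeasure (m.restrict s) := ⟨by simpa using hm⟩
  obtain ⟨C, hC⟩ := hΩ.isCompact_closure.exists_bound_of_continuousOn hv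
  have hvm : MemLp v 2 (m.restrict s) :=
    MemLp.of_bound ((hv.mono hsub).aestronglyMeasurable hs) C
      ((ae_restrict_iff' hs).2 (Eventually.of_forall fun x hx => hC x (hsub hx)))
  have h := L2.integrable_inner (𝕜 := ℝ) f hvm.toLp
  refine h.congr ?_
  filter_upwards [hvm.coeFn_toLp] with x hx
  rw [hx]

/-- A continuous curve on `[0, b]` whose derivative vanishes in `(0, b)` is constant. -/
theorem eq_of_hasDerivAt_zero_Ioo {E : Type*} [NormedAddCommGroup E] [InnerProductSpace ℝ E]
    {f : ℝ → E} {b t : ℝ} (hf : ContinuousOn f (Icc 0 b))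
    (hf' : ∀ t ∈ Ioo 0 b, HasDerivAt f 0 t) (ht : t ∈ Icc 0 b) : f t = f 0 := by
  rcases ht.1.eq_or_lt with rfl | h0
  · rfl
  -- Pairing with the fixed vector `f t - f 0` makes the mean value theorem applicable; the
  -- vanishing slope then gives `‖f t - f 0‖² = 0`.
  obtain ⟨c, hc, h⟩ := exists_hasDerivAt_eq_slope (fun s => inner ℝ (f t - f 0) (f s)) (fun _ => 0)
    h0 (continuousOn_const.inner (hf.mono (Icc_subset_Icc_right ht.2)))
    (fun s hs => by
      simpa using (hasDerivAt_const s (f t - f 0)).inner ℝ (hf' s ⟨hs.1, hs.2.trans_le ht.2⟩))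
  rw [← inner_sub_right, eq_comm, div_eq_zero_iff, inner_self_eq_zero, sub_eq_zero] at h
  exact h.resolve_right (by linarith)

end MaxwellFEM

/-! ### Quadratic minimisation -/

/-- For a symmetric positive semidefinite form `a` and a finite-dimensional subspace `S`, every
vector has an `a`-orthogonal projection onto `S`. -/
theorem LinearMap.exists_mem_forall_eq_of_nonneg {P : Type*} [AddCommGroup P] [Module ℝ P]
    (a : P →ₗ[ℝ] P →ₗ[ℝ] ℝ) (hsymm : ∀ x y, a x y = a y x) (hpos : ∀ x, 0 ≤ a x x)
    (S : Submodule ℝ P) [FiniteDimensional ℝ S] (p : P) :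
    ∃ z ∈ S, ∀ v ∈ S, a z v = a p v := by
  let A : S →ₗ[ℝ] Module.Dual ℝ S := (a.domRestrict S).compl₂ S.subtype
  -- In finite dimension `A z = a p` is solvable on `S` once the right-hand side annihilates the
  -- kernel of `A`.
  have hmem : (a p).comp S.subtype ∈ A.ker.dualAnnihilator := by
    rw [Submodule.mem_dualAnnihilator]
    intro w hw
    have hww : a w w = 0 := DFunLike.congr_fun (LinearMap.mem_ker.1 hw) w
    change a p w = 0
    -- Since `a w w = 0`, the value of the form at `p + t w` is affine in `t`; being nonnegative for
    -- all `t`, it has slope zero.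
    have key : ∀ t : ℝ, 0 ≤ a p p + t * (2 * a p w) := by
      intro t
      have h := hpos (p + t • (w : P))
      simp only [map_add, map_smul, LinearMap.add_apply, LinearMap.smul_apply, smul_eq_mul, hww,
        hsymm w p] at h
      linarith
    by_contra hne
    have h := key (-(a p p + 1) / (2 * a p w))
    rw [div_mul_cancel₀ _ (mul_ne_zero two_ne_zero hne)] at h
    linarith
  rw [← LinearMap.range_dualMap_eq_dualAnnihilator_ker] at hmem
  obtain ⟨Φ, hΦ⟩ := hmem
  -- `Φ` lies in the bidual of `S`, so reflexivity supplies `z`; symmetry of `a` identifies the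
  -- transpose of `A` with `A`.
  obtain ⟨z, rfl⟩ := (Module.evalEquiv ℝ S).surjective Φ
  refine ⟨z, z.2, fun v hv => ?_⟩
  have h := DFunLike.congr_fun hΦ ⟨v, hv⟩
  rw [hsymm]
  exact h

namespace MaxwellFEM

open Filter Topology

variable {d : ℕ}

/-! ### The elasticity tensor -/

theorem ddot_comm (A B : Mat d) : ddot A B = ddot B A := by
  simp [ddot, mul_comm]

theorem ddot_self_nonneg (A : Mat d) : 0 ≤ ddot A A :=
  Finset.sum_nonneg fun _ _ => Finset.sum_nonneg fun _ _ => mul_self_nonneg _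

theorem ddot_add_left (A A' B : Mat d) : ddot (A + A') B = ddot A B + ddot A' B := by
  simp [ddot, add_mul, Finset.sum_add_distrib]

theorem ddot_smul_left (c : ℝ) (A B : Mat d) : ddot (c • A) B = c * ddot A B := by
  simp [ddot, mul_assoc, Finset.mul_sum]

/-- The Kronecker deltas collapse the sums; linearity and both symmetries of the tensor are then
read off from trace and transpose. -/
theorem applyC_eq (lam mu : ℝ) (A : Mat d) :
    applyC lam mu A = (lam * A.trace) • (1 : Mat d) + mu • (A + A.transpose) := by
  ext i j
  simp only [applyC, elast, delta, Matrix.of_apply, Matrix.add_apply, Matrix.smul_apply,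
    Matrix.transpose_apply, Matrix.one_apply, smul_eq_mul, Matrix.trace, Matrix.diag]
  simp [add_mul, mul_add, Finset.sum_add_distrib, Finset.mul_sum]

theorem applyC_isSymm (lam mu : ℝ) (A : Mat d) : (applyC lam mu A).IsSymm := by
  rw [applyC_eq, Matrix.IsSymm]
  simp [add_comm]

theorem applyC_add (lam mu : ℝ) (A B : Mat d) :
    applyC lam mu (A + B) = applyC lam mu A + applyC lam mu B := by
  simp only [applyC_eq, Matrix.trace_add, Matrix.transpose_add]
  module

theorem applyC_smul (lam mu c : ℝ) (A : Mat d) :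
    applyC lam mu (c • A) = c • applyC lam mu A := by
  simp only [applyC_eq, Matrix.trace_smul, Matrix.transpose_smul, smul_eq_mul]
  module

theorem ddot_applyC_eq (lam mu : ℝ) (A B : Mat d) :
    ddot (applyC lam mu A) B = ∑ i, ∑ j, ∑ k, ∑ l, elast lam mu i j k l * B i j * A k l := by
  simp only [ddot, applyC, Matrix.of_apply, Finset.sum_mul]
  refine Finset.sum_congr rfl fun i _ => Finset.sum_congr rfl fun j _ =>
    Finset.sum_congr rfl fun k _ => Finset.sum_congr rfl fun l _ => by ring

theorem ddot_applyC_comm (lam mu : ℝ) (A B : Mat d) :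
    ddot (applyC lam mu A) B = ddot (applyC lam mu B) A := by
  have hone : ∀ M : Mat d, ddot 1 M = M.trace := fun M => by
    simp [ddot, Matrix.one_apply, Matrix.trace]
  have htr : ddot A.transpose B = ddot B.transpose A := by
    simp only [ddot, Matrix.transpose_apply]
    rw [Finset.sum_comm]
    simp only [mul_comm]
  simp only [applyC_eq, ddot_add_left, ddot_smul_left, hone, htr, ddot_comm A B]
  ring

theorem TensorPositive.ddot_applyC_nonneg {lam mu : ℝ} (hC : TensorPositive d lam mu) {A : Mat d}
    (hA : A.IsSymm) : 0 ≤ ddot (applyC lam mu A) A := by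
  obtain ⟨c, hc, h⟩ := hC
  rw [ddot_applyC_eq]
  exact le_trans (mul_nonneg hc.le
    (Finset.sum_nonneg fun _ _ => Finset.sum_nonneg fun _ _ => sq_nonneg _)) (h A hA)

/-! ### The mesh -/

theorem convex_simplex (s : Finset (Vec d)) : Convex ℝ (simplex s) := convex_convexHull ℝ _

theorem isCompact_simplex (s : Finset (Vec d)) : IsCompact (simplex s) :=
  s.finite_toSet.isCompact_convexHull ℝ

theorem interior_simplex_ae_eq (s : Finset (Vec d)) :
    (interior (simplex s) : Set (Vec d)) =ᵐ[volume] simplex s :=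
  interior_ae_eq_of_null_frontier ((convex_simplex s).addHaar_frontier (volume : Measure (Vec d)))

/-- The frontier of a convex set is null. Derivatives therefore need to be known only in open
simplices, where a single affine piece is seen. -/
theorem ae_restrict_simplex_mem_interior (s : Finset (Vec d)) :
    ∀ᵐ x ∂(volume.restrict (simplex s)), x ∈ interior (simplex s) := by
  rw [← Measure.restrict_congr_set (interior_simplex_ae_eq s)]
  exact ae_restrict_mem isOpen_interior.measurableSet

namespace IsTriangulation

variable {T : Finset (Finset (Vec d))} {Ω : Set (Vec d)}

theorem subset_iUnion (h : IsTriangulation T Ω) : Ω ⊆ ⋃ s ∈ T, simplex s :=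
  h.eq_interior.trans_subset interior_subset

theorem interior_nonempty (h : IsTriangulation T Ω) {s : Finset (Vec d)} (hs : s ∈ T) :
    (interior (simplex s)).Nonempty := by
  rw [simplex, interior_convexHull_nonempty_iff_affineSpan_eq_top]
  have h1 := (h.affineIndependent s hs).affineSpan_eq_top_iff_card_eq_finrank_add_one.2
    (by simp [h.card_eq s hs])
  simpa using h1

/-- A property that holds almost everywhere on every simplex holds almost everywhere in `Ω`. -/
theorem ae_restrict (h : IsTriangulation T Ω) {p : Vec d → Prop}
    (hp : ∀ s ∈ T, ∀ᵐ x ∂(volume.restrict (simplex s)), p x) :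
    ∀ᵐ x ∂(volume.restrict Ω), p x :=
  ae_restrict_of_ae_restrict_of_subset h.subset_iUnion
    ((ae_restrict_biUnion_finset_iff _ _ _).2 hp)

end IsTriangulation

/-! ### Piecewise constant fields -/

/-- This covers sums, multiples and the elasticity tensor at once; unary operations ignore the
second argument. -/
theorem mem_Psih_map₂ {T : Finset (Finset (Vec d))} {G : Mat d → Mat d → Mat d}
    (hG : ∀ A B : Mat d, A.IsSymm → B.IsSymm → (G A B).IsSymm) {φ ψ : Vec d → Mat d}
    (hφ : φ ∈ Psih T) (hψ : ψ ∈ Psih T) : (fun x => G (φ x) (ψ x)) ∈ Psih T := by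
  intro s hs
  obtain ⟨A, hA, hA'⟩ := hφ s hs
  obtain ⟨B, hB, hB'⟩ := hψ s hs
  refine ⟨G A B, hG A B hA hB, ?_⟩
  filter_upwards [hA', hB'] with x hx hx'
  rw [hx, hx']

/-- The space `Ψ_h` as a subspace of the space of all matrix fields. -/
noncomputable def PsihSubmodule (T : Finset (Finset (Vec d))) : Submodule ℝ (Vec d → Mat d) where
  carrier := Psih T
  add_mem' hφ hψ := mem_Psih_map₂ (G := fun A B => A + B) (fun _ _ hA hB => hA.add hB) hφ hψ
  zero_mem' := fun _ _ => ⟨0, Matrix.isSymm_zero, by simp⟩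
  smul_mem' c φ hφ :=
    mem_Psih_map₂ (G := fun A _ => c • A) (fun _ _ hA _ => hA.smul c) hφ hφ

/-- Application of the elasticity tensor to piecewise constant fields. -/
noncomputable def applyCPsih (T : Finset (Finset (Vec d))) (lam mu : ℝ) :
    PsihSubmodule T →ₗ[ℝ] PsihSubmodule T where
  toFun φ := ⟨fun x => applyC lam mu (φ.1 x),
    mem_Psih_map₂ (G := fun A _ => applyC lam mu A) (fun _ _ _ _ => applyC_isSymm _ _ _) φ.2 φ.2⟩
  map_add' φ ψ := Subtype.ext (funext fun x => applyC_add lam mu (φ.1 x) (ψ.1 x))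
  map_smul' c φ := Subtype.ext (funext fun x => applyC_smul lam mu c (φ.1 x))

namespace IsTriangulation

variable {T : Finset (Finset (Vec d))} {Ω : Set (Vec d)}

theorem integrableOn_ddot (h : IsTriangulation T Ω) {φ ψ : Vec d → Mat d}
    (hφ : φ ∈ Psih T) (hψ : ψ ∈ Psih T) :
    IntegrableOn (fun x => ddot (φ x) (ψ x)) Ω := by
  refine IntegrableOn.mono_set (integrableOn_finset_iUnion.2 fun s hs => ?_) h.subset_iUnion
  obtain ⟨A, -, hA⟩ := hφ s hs
  obtain ⟨B, -, hB⟩ := hψ s hs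
  have hc : IntegrableOn (fun _ => ddot A B) (simplex s) :=
    integrableOn_const (isCompact_simplex s).measure_lt_top.ne
  refine Integrable.congr hc ?_
  filter_upwards [hA, hB] with x hx hx'
  rw [hx, hx']

theorem ae_isSymm (h : IsTriangulation T Ω) {φ : Vec d → Mat d} (hφ : φ ∈ Psih T) :
    ∀ᵐ x ∂(volume.restrict Ω), (φ x).IsSymm := by
  refine h.ae_restrict fun s hs => ?_
  obtain ⟨A, hA, hA'⟩ := hφ s hs
  filter_upwards [hA'] with x hx
  rwa [hx]

end IsTriangulation

theorem innerPsi_comm (Ω : Set (Vec d)) (φ ψ : Vec d → Mat d) :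
    innerPsi Ω φ ψ = innerPsi Ω ψ φ := by
  simp only [innerPsi, ddot_comm]

theorem innerPsi_self_nonneg (Ω : Set (Vec d)) (φ : Vec d → Mat d) : 0 ≤ innerPsi Ω φ φ :=
  integral_nonneg fun _ => ddot_self_nonneg _

theorem innerPsi_congr {Ω : Set (Vec d)} {φ φ' ψ ψ' : Vec d → Mat d}
    (hφ : φ =ᵐ[volume.restrict Ω] φ') (hψ : ψ =ᵐ[volume.restrict Ω] ψ') :
    innerPsi Ω φ ψ = innerPsi Ω φ' ψ' := by
  refine integral_congr_ae ?_
  filter_upwards [hφ, hψ] with x hx hx'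
  rw [hx, hx']

theorem innerPsi_add_left {T : Finset (Finset (Vec d))} {Ω : Set (Vec d)}
    (h : IsTriangulation T Ω) {φ φ' ψ : Vec d → Mat d}
    (hφ : φ ∈ Psih T) (hφ' : φ' ∈ Psih T) (hψ : ψ ∈ Psih T) :
    innerPsi Ω (φ + φ') ψ = innerPsi Ω φ ψ + innerPsi Ω φ' ψ := by
  simp only [innerPsi, Pi.add_apply, ddot_add_left]
  exact integral_add (h.integrableOn_ddot hφ hψ) (h.integrableOn_ddot hφ' hψ)

theorem innerPsi_smul_left (Ω : Set (Vec d)) (c : ℝ) (φ ψ : Vec d → Mat d) :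
    innerPsi Ω (c • φ) ψ = c * innerPsi Ω φ ψ := by
  simp only [innerPsi, Pi.smul_apply, ddot_smul_left]
  exact integral_const_mul _ _

/-- The scalar product of `Ψ` on `Ψ_h`, as a bilinear form. -/
noncomputable def innerPsiForm {T : Finset (Finset (Vec d))} {Ω : Set (Vec d)}
    (h : IsTriangulation T Ω) :
    PsihSubmodule T →ₗ[ℝ] PsihSubmodule T →ₗ[ℝ] ℝ :=
  LinearMap.mk₂ ℝ (fun φ ψ => innerPsi Ω φ ψ)
    (fun φ φ' ψ => innerPsi_add_left h φ.2 φ'.2 ψ.2)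
    (fun c φ ψ => innerPsi_smul_left Ω c φ ψ)
    (fun φ ψ ψ' => by
      rw [innerPsi_comm, innerPsi_comm Ω φ, innerPsi_comm Ω φ]
      exact innerPsi_add_left h ψ.2 ψ'.2 φ.2)
    (fun c φ ψ => by
      rw [innerPsi_comm, innerPsi_comm Ω φ]
      exact innerPsi_smul_left Ω c ψ φ)

/-- The scalar product weighted by the elasticity tensor on `Ψ_h`, as a bilinear form. -/
noncomputable def innerCForm {T : Finset (Finset (Vec d))} {Ω : Set (Vec d)}
    (h : IsTriangulation T Ω)
    (lam mu : ℝ) : PsihSubmodule T →ₗ[ℝ] PsihSubmodule T →ₗ[ℝ] ℝ :=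
  (innerPsiForm h).comp (applyCPsih T lam mu)

theorem innerCForm_comm {T : Finset (Finset (Vec d))} {Ω : Set (Vec d)} (h : IsTriangulation T Ω)
    (lam mu : ℝ) (φ ψ : PsihSubmodule T) :
    innerCForm h lam mu φ ψ = innerCForm h lam mu ψ φ :=
  integral_congr_ae (Eventually.of_forall fun _ => ddot_applyC_comm _ _ _ _)

theorem innerCForm_self_nonneg {T : Finset (Finset (Vec d))} {Ω : Set (Vec d)}
    (h : IsTriangulation T Ω) {lam mu : ℝ} (hC : TensorPositive d lam mu) (φ : PsihSubmodule T) :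
    0 ≤ innerCForm h lam mu φ φ :=
  integral_nonneg_of_ae <| by
    filter_upwards [h.ae_isSymm φ.2] with x hx
    exact hC.ddot_applyC_nonneg hx

theorem normPsi_sq (Ω : Set (Vec d)) (φ : Vec d → Mat d) :
    normPsi Ω φ ^ 2 = innerPsi Ω φ φ :=
  Real.sq_sqrt (innerPsi_self_nonneg Ω φ)

/-- The representative `ψ` in `Ψ_h` is symmetric almost everywhere, so the tensor is nonnegative on
it and the square root is undone by squaring. -/
theorem normC_sq {T : Finset (Finset (Vec d))} {Ω : Set (Vec d)}
    (h : IsTriangulation T Ω) {lam mu : ℝ} (hC : TensorPositive d lam mu) {φ : Vec d → Mat d}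
    (ψ : PsihSubmodule T) (hφ : φ =ᵐ[volume.restrict Ω] ψ) :
    normC lam mu Ω φ ^ 2 = innerCForm h lam mu ψ ψ := by
  have heq : innerC lam mu Ω φ φ = innerCForm h lam mu ψ ψ :=
    innerPsi_congr (by filter_upwards [hφ] with x hx; rw [hx]; rfl) hφ
  rw [normC, heq, Real.sq_sqrt (innerCForm_self_nonneg h hC ψ)]

/-! ### Piecewise affine functions -/

/-- The space `X_h` as a subspace of the space of all vector fields. -/
noncomputable def XhSubmodule (T : Finset (Finset (Vec d))) (Ω : Set (Vec d)) :
    Submodule ℝ (Vec d → Vec d) where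
  carrier := Xh T Ω
  add_mem' {u v} hu hv := ⟨hu.1.add hv.1, fun s hs => by
    obtain ⟨A, hA⟩ := hu.2 s hs
    obtain ⟨B, hB⟩ := hv.2 s hs
    exact ⟨A + B, fun x hx => by simp [hA hx, hB hx]⟩⟩
  zero_mem' := ⟨continuousOn_const, fun _ _ => ⟨0, fun _ _ => rfl⟩⟩
  smul_mem' c u hu := ⟨hu.1.const_smul c, fun s hs => by
    obtain ⟨A, hA⟩ := hu.2 s hs
    exact ⟨c • A, fun x hx => by simp [hA hx]⟩⟩

/-- The space `V_h` as a subspace of `X_h`. -/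
def VhSubmodule (T : Finset (Finset (Vec d))) (Ω Γ₀ : Set (Vec d)) :
    Submodule ℝ (XhSubmodule T Ω) where
  carrier := {v | (v : Vec d → Vec d) ∈ Vh T Ω Γ₀ 0}
  add_mem' {u v} hu hv := ⟨(u + v).2, by
    filter_upwards [hu.2, hv.2] with x hx hx'
    simp [hx, hx']⟩
  zero_mem' := ⟨(0 : XhSubmodule T Ω).2, by simp⟩
  smul_mem' c u hu := ⟨(c • u).2, by
    filter_upwards [hu.2] with x hx
    simp [hx]⟩

theorem hasFDerivAt_of_eqOn_affine {u : Vec d → Vec d} {A : Vec d →ᵃ[ℝ] Vec d} {s : Set (Vec d)}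
    (hu : EqOn u A s) {x : Vec d} (hx : x ∈ interior s) :
    HasFDerivAt u A.linear.toContinuousLinearMap x := by
  have h1 : HasFDerivAt (fun y => A.linear.toContinuousLinearMap y + A 0)
      A.linear.toContinuousLinearMap x :=
    A.linear.toContinuousLinearMap.hasFDerivAt.add_const _
  refine h1.congr_of_eventuallyEq ?_
  filter_upwards [mem_interior_iff_mem_nhds.1 hx] with y hy
  rw [hu hy]
  exact congrFun A.decomp y

/-- The union of the open simplices. -/
def openSimplices (T : Finset (Finset (Vec d))) : Set (Vec d) :=
  ⋃ s ∈ T, interior (simplex s)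

theorem differentiableAt_of_mem_Xh {T : Finset (Finset (Vec d))} {Ω : Set (Vec d)}
    {u : Vec d → Vec d} (hu : u ∈ Xh T Ω) {x : Vec d} (hx : x ∈ openSimplices T) :
    DifferentiableAt ℝ u x := by
  simp only [openSimplices, mem_iUnion] at hx
  obtain ⟨s, hs, hx⟩ := hx
  obtain ⟨A, hA⟩ := hu.2 s hs
  exact (hasFDerivAt_of_eqOn_affine hA hx).differentiableAt

theorem strain_add {u v : Vec d → Vec d} {x : Vec d} (hu : DifferentiableAt ℝ u x)
    (hv : DifferentiableAt ℝ v x) : strain (u + v) x = strain u x + strain v x := by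
  ext i j
  simp [strain, grad, fderiv_add hu hv]
  ring

theorem strain_smul (c : ℝ) {u : Vec d → Vec d} {x : Vec d} (hu : DifferentiableAt ℝ u x) :
    strain (c • u) x = c • strain u x := by
  ext i j
  simp [strain, grad, fderiv_const_smul hu c]
  ring

theorem strain_eq_strain_of_mem_interior {T : Finset (Finset (Vec d))} {Ω : Set (Vec d)}
    {u : Vec d → Vec d} (hu : u ∈ Xh T Ω) {s : Finset (Vec d)} (hs : s ∈ T) {x y : Vec d}
    (hx : x ∈ interior (simplex s)) (hy : y ∈ interior (simplex s)) :
    strain u x = strain u y := by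
  obtain ⟨A, hA⟩ := hu.2 s hs
  simp only [strain, grad, (hasFDerivAt_of_eqOn_affine hA hx).fderiv,
    (hasFDerivAt_of_eqOn_affine hA hy).fderiv]

theorem strain_isSymm (u : Vec d → Vec d) (x : Vec d) : (strain u x).IsSymm := by
  simp [strain, Matrix.IsSymm, add_comm]

/-- The strain of a piecewise affine function, set to zero outside the open simplices. -/
noncomputable def strainXh {T : Finset (Finset (Vec d))} {Ω : Set (Vec d)}
    (h : IsTriangulation T Ω) : XhSubmodule T Ω →ₗ[ℝ] PsihSubmodule T where
  -- Off the open simplices differentiability may fail, and `fderiv` is then not additive. The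
  -- cut-off makes the map linear at every point and changes the strain only on a null subset of
  -- `Ω`.
  toFun u := ⟨(openSimplices T).indicator (strain u), fun s hs => by
    obtain ⟨y, hy⟩ := h.interior_nonempty hs
    refine ⟨strain u y, strain_isSymm _ _, ?_⟩
    filter_upwards [ae_restrict_simplex_mem_interior s] with x hx
    rw [indicator_of_mem (show x ∈ openSimplices T from mem_biUnion hs hx)]
    exact strain_eq_strain_of_mem_interior u.2 hs hx hy⟩
  map_add' u v := by
    ext1; funext x
    by_cases hx : x ∈ openSimplices T
    · simpa [hx] using strain_add (differentiableAt_of_mem_Xh u.2 hx)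
        (differentiableAt_of_mem_Xh v.2 hx)
    · simp [hx]
  map_smul' c u := by
    ext1; funext x
    by_cases hx : x ∈ openSimplices T
    · simpa [hx] using strain_smul c (differentiableAt_of_mem_Xh u.2 hx)
    · simp [hx]

theorem strainXh_apply {T : Finset (Finset (Vec d))} {Ω : Set (Vec d)} (h : IsTriangulation T Ω)
    (u : XhSubmodule T Ω) {s : Finset (Vec d)} (hs : s ∈ T) {x : Vec d}
    (hx : x ∈ interior (simplex s)) : (strainXh h u : Vec d → Mat d) x = strain u x :=
  indicator_of_mem (s := openSimplices T) (mem_biUnion hs hx) _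

theorem strain_ae_eq_strainXh {T : Finset (Finset (Vec d))} {Ω : Set (Vec d)}
    (h : IsTriangulation T Ω) (u : XhSubmodule T Ω) :
    strain u =ᵐ[volume.restrict Ω] (strainXh h u : Vec d → Mat d) := by
  refine h.ae_restrict fun s hs => ?_
  filter_upwards [ae_restrict_simplex_mem_interior s] with x hx
  exact (strainXh_apply h u hs hx).symm

/-- Elements of `X_h` are unconstrained away from the mesh, so finiteness has to come from the
strains: these are determined by their values at one point of each open simplex. -/
instance finiteDimensional_range_strainXh {T : Finset (Finset (Vec d))} {Ω : Set (Vec d)}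
    (h : IsTriangulation T Ω) : FiniteDimensional ℝ (LinearMap.range (strainXh h)) := by
  choose b hb using fun s : T => h.interior_nonempty s.2
  let ev : LinearMap.range (strainXh h) →ₗ[ℝ] (T → Mat d) :=
    { toFun := fun φ s => (φ : Vec d → Mat d) (b s)
      map_add' := fun _ _ => rfl
      map_smul' := fun _ _ => rfl }
  refine FiniteDimensional.of_injective ev ?_
  rintro ⟨_, u, rfl⟩ ⟨_, v, rfl⟩ huv
  ext1; ext1; funext x
  by_cases hx : x ∈ openSimplices T
  · simp only [openSimplices, mem_iUnion] at hx
    obtain ⟨s, hs, hx⟩ := hx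
    have h1 : (strainXh h u : Vec d → Mat d) (b ⟨s, hs⟩) =
        (strainXh h v : Vec d → Mat d) (b ⟨s, hs⟩) := congrFun huv ⟨s, hs⟩
    rw [strainXh_apply h u hs (hb ⟨s, hs⟩), strainXh_apply h v hs (hb ⟨s, hs⟩)] at h1
    rwa [strainXh_apply h u hs hx, strainXh_apply h v hs hx,
      strain_eq_strain_of_mem_interior u.2 hs hx (hb ⟨s, hs⟩),
      strain_eq_strain_of_mem_interior v.2 hs hx (hb ⟨s, hs⟩)]
  · exact (indicator_of_notMem hx _).trans (indicator_of_notMem hx _).symm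

/-! ### Energy minimisation in the finite element spaces -/

/-- The load is linear on `X_h`. -/
theorem exists_load_linearMap (hd : 1 ≤ d) {Ω Γ₀ : Set (Vec d)} (hΩ : IsBoundedLipschitzDomain Ω)
    (T : Finset (Finset (Vec d))) (f : L2vol Ω) (q : L2surf (neumannPart Ω Γ₀)) :
    ∃ L : XhSubmodule T Ω →ₗ[ℝ] ℝ, ∀ v : XhSubmodule T Ω, L v = load f q v := by
  have hf : ∀ v : XhSubmodule T Ω, IntegrableOn (fun x => inner ℝ (f x) (v.1 x)) Ω := fun v =>
    integrable_inner_of_continuousOn hΩ.isBounded hΩ.isOpen.measurableSet subset_closure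
      hΩ.isBounded.measure_lt_top f v.2.1
  have hq : ∀ v : XhSubmodule T Ω,
      IntegrableOn (fun x => inner ℝ (q x) (v.1 x)) (neumannPart Ω Γ₀) (surfaceMeasure d) :=
    fun v => integrable_inner_of_continuousOn hΩ.isBounded
      (isClosed_frontier.measurableSet.diff isClosed_closure.measurableSet)
      (sdiff_subset.trans frontier_subset_closure)
      ((measure_mono sdiff_subset).trans_lt (surfaceMeasure_frontier_lt_top hd hΩ)) q v.2.1
  refine ⟨{ toFun := fun v => load f q v, map_add' := fun u v => ?_, map_smul' := fun c v => ?_ },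
    fun _ => rfl⟩
  · simp only [load, Submodule.coe_add, Pi.add_apply, inner_add_right]
    rw [integral_add (hf u) (hf v), integral_add (hq u) (hq v)]
    ring
  · simp only [load, Submodule.coe_smul, Pi.smul_apply, inner_smul_right, integral_const_mul,
      smul_eq_mul, RingHom.id_apply, mul_add]

section Energy

variable {T : Finset (Finset (Vec d))} {Ω Γ₀ : Set (Vec d)} (h : IsTriangulation T Ω)
  {lam mu alpha : ℝ} (hC : TensorPositive d lam mu) {ℓ : (Vec d → Vec d) → ℝ}
  {L : XhSubmodule T Ω →ₗ[ℝ] ℝ} (hL : ∀ v : XhSubmodule T Ω, L v = ℓ v)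

include hC hL in
-- This removes the integrals: statements about the energy become identities for bilinear forms.
theorem energy_eq (u : XhSubmodule T Ω) (φ : PsihSubmodule T) :
    energy lam mu alpha Ω ℓ u φ =
      1 / 2 * innerCForm h lam mu (strainXh h u - φ) (strainXh h u - φ)
        + alpha / 2 * innerPsiForm h φ φ - L u := by
  rw [energy, normC_sq h hC (strainXh h u - φ), normPsi_sq, hL]
  · rfl
  · filter_upwards [strain_ae_eq_strainXh h u] with x hx
    simp [hx]

theorem innerPsi_stress (u v : XhSubmodule T Ω) (φ : PsihSubmodule T) :
    innerPsi Ω (stress lam mu u φ) (strain v) =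
      innerCForm h lam mu (strainXh h u - φ) (strainXh h v) := by
  refine innerPsi_congr ?_ (strain_ae_eq_strainXh h v)
  filter_upwards [strain_ae_eq_strainXh h u] with x hx
  rw [stress, hx]
  rfl

theorem sub_mem_VhSubmodule {g : Vec d → Vec d} {u v : XhSubmodule T Ω}
    (hu : (u : Vec d → Vec d) ∈ Vh T Ω Γ₀ g) (hv : (v : Vec d → Vec d) ∈ Vh T Ω Γ₀ g) :
    u - v ∈ VhSubmodule T Ω Γ₀ := by
  refine ⟨(u - v).2, ?_⟩
  filter_upwards [hu.2, hv.2] with x hx hx'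
  simp [hx, hx']

theorem add_mem_Vh {g : Vec d → Vec d} {u v : XhSubmodule T Ω}
    (hu : (u : Vec d → Vec d) ∈ Vh T Ω Γ₀ g) (hv : v ∈ VhSubmodule T Ω Γ₀) :
    ((u + v : XhSubmodule T Ω) : Vec d → Vec d) ∈ Vh T Ω Γ₀ g := by
  refine ⟨(u + v).2, ?_⟩
  filter_upwards [hu.2, hv.2] with x hx hx'
  simp [hx, hx']

include hC hL in
/-- A function that satisfies the discrete balance of forces minimises the energy. -/
theorem isLeast_energyValues_of_balance {g : Vec d → Vec d} {u : XhSubmodule T Ω}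
    (hu : (u : Vec d → Vec d) ∈ Vh T Ω Γ₀ g) (φ : PsihSubmodule T)
    (hbal : ∀ w ∈ VhSubmodule T Ω Γ₀,
      innerCForm h lam mu (strainXh h u - φ) (strainXh h w) = L w) :
    IsLeast (energyValues lam mu alpha Ω ℓ (Vh T Ω Γ₀ g) φ) (energy lam mu alpha Ω ℓ u φ) := by
  refine ⟨⟨u, hu, rfl⟩, ?_⟩
  rintro _ ⟨v, hv, rfl⟩
  lift v to XhSubmodule T Ω using hv.1
  obtain ⟨w, rfl⟩ : ∃ w, v = u + w := ⟨v - u, by abel⟩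
  have hw : w ∈ VhSubmodule T Ω Γ₀ := by simpa using sub_mem_VhSubmodule hv hu
  change energy lam mu alpha Ω ℓ u φ ≤ energy lam mu alpha Ω ℓ (u + w : XhSubmodule T Ω) φ
  rw [energy_eq h hC hL, energy_eq h hC hL, map_add (strainXh h),
    add_sub_right_comm (strainXh h u)]
  -- The terms linear in `w` cancel by the balance, and `E(u + w) - E(u) = ‖e[w]‖_C² / 2` remains.
  have h1 := hbal w hw
  have h2 := innerCForm_self_nonneg h hC (strainXh h w)
  have h3 := innerCForm_comm h lam mu (strainXh h w) (strainXh h u - φ)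
  simp only [map_add, LinearMap.add_apply]
  linarith

include hC in
/-- The response of the equilibrium displacement to a change `ψ` of the internal variable. -/
theorem exists_strain_projection (ψ : PsihSubmodule T) :
    ∃ z ∈ VhSubmodule T Ω Γ₀, ∀ w ∈ VhSubmodule T Ω Γ₀,
      innerCForm h lam mu (strainXh h z - ψ) (strainXh h w) = 0 := by
  have hle : (VhSubmodule T Ω Γ₀).map (strainXh h) ≤ LinearMap.range (strainXh h) :=
    LinearMap.map_le_range
  have := Submodule.finiteDimensional_of_le hle
  -- The form is only semidefinite on these function spaces, as fields may differ on null sets;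
  -- existence of the projection does not need more.
  obtain ⟨_, ⟨z, hz, rfl⟩, hzw⟩ := LinearMap.exists_mem_forall_eq_of_nonneg
    (innerCForm h lam mu) (innerCForm_comm h lam mu) (innerCForm_self_nonneg h hC)
    ((VhSubmodule T Ω Γ₀).map (strainXh h)) ψ
  refine ⟨z, hz, fun w hw => ?_⟩
  rw [map_sub, LinearMap.sub_apply, hzw _ ⟨w, hw, rfl⟩, sub_self]

include hC hL in
/-- Along every line in `Ψ_h` through `φ`, the energy is minimised along a line in `V_h(g)`
through an equilibrium displacement `u` of `φ`. -/
theorem exists_isLeast_energyValues_line {g : Vec d → Vec d} {u : XhSubmodule T Ω}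
    (hu : (u : Vec d → Vec d) ∈ Vh T Ω Γ₀ g) (φ : PsihSubmodule T)
    (hbal : ∀ w ∈ VhSubmodule T Ω Γ₀,
      innerCForm h lam mu (strainXh h u - φ) (strainXh h w) = L w) (ψ : PsihSubmodule T) :
    ∃ z ∈ VhSubmodule T Ω Γ₀, ∀ ε : ℝ,
      IsLeast (energyValues lam mu alpha Ω ℓ (Vh T Ω Γ₀ g) (φ + ε • ψ : PsihSubmodule T))
        (energy lam mu alpha Ω ℓ (u + ε • z : XhSubmodule T Ω) (φ + ε • ψ : PsihSubmodule T)) := by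
  obtain ⟨z, hz, hzw⟩ := exists_strain_projection (Γ₀ := Γ₀) h hC ψ
  refine ⟨z, hz, fun ε => ?_⟩
  refine isLeast_energyValues_of_balance h hC hL
    (add_mem_Vh hu (Submodule.smul_mem _ ε hz)) _ fun w hw => ?_
  -- The extra elastic strain `ε (e[z] - ψ)` is `C`-orthogonal to all strains of `V_h`, so the
  -- balance persists along the line.
  rw [← hbal w hw, map_add, map_smul,
    show strainXh h u + ε • strainXh h z - (φ + ε • ψ)
      = (strainXh h u - φ) + ε • (strainXh h z - ψ) by module]
  rw [map_add, map_smul, LinearMap.add_apply, LinearMap.smul_apply, hzw w hw, smul_zero, add_zero]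

include hC hL in
/-- The directional derivatives of the reduced energy. -/
theorem hasDerivAt_reducedEnergy {g : Vec d → Vec d} {u : XhSubmodule T Ω}
    (hu : (u : Vec d → Vec d) ∈ Vh T Ω Γ₀ g) (φ : PsihSubmodule T)
    (hbal : ∀ w ∈ VhSubmodule T Ω Γ₀,
      innerCForm h lam mu (strainXh h u - φ) (strainXh h w) = L w) (ψ : PsihSubmodule T) :
    HasDerivAt
      (fun ε : ℝ => reducedEnergy lam mu alpha Ω ℓ (Vh T Ω Γ₀ g)
        ((φ : Vec d → Mat d) + ε • (ψ : Vec d → Mat d)))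
      (alpha * innerPsiForm h φ ψ - innerCForm h lam mu (strainXh h u - φ) ψ) 0 := by
  obtain ⟨z, hz, hmin⟩ := exists_isLeast_energyValues_line (alpha := alpha) h hC hL hu φ hbal ψ
  have hz' := hbal z hz
  have hcomm := innerCForm_comm h lam mu (strainXh h z - ψ) (strainXh h u - φ)
  have hcomm' : innerPsiForm h ψ φ = innerPsiForm h φ ψ := innerPsi_comm _ _ _
  set c₂ : ℝ := 1 / 2 * innerCForm h lam mu (strainXh h z - ψ) (strainXh h z - ψ)
    + alpha / 2 * innerPsiForm h ψ ψ
  set c₁ : ℝ := alpha * innerPsiForm h φ ψ - innerCForm h lam mu (strainXh h u - φ) ψ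
  have heq : (fun ε : ℝ => reducedEnergy lam mu alpha Ω ℓ (Vh T Ω Γ₀ g)
      ((φ : Vec d → Mat d) + ε • (ψ : Vec d → Mat d))) =
      fun ε : ℝ => energy lam mu alpha Ω ℓ u φ + (c₁ * ε + c₂ * ε ^ 2) := by
    funext ε
    refine (hmin ε).csInf_eq.trans ?_
    rw [energy_eq h hC hL, energy_eq h hC hL, map_add, map_smul,
      show strainXh h u + ε • strainXh h z - (φ + ε • ψ)
        = (strainXh h u - φ) + ε • (strainXh h z - ψ) by module]
    -- The balance tested with `z` makes the load contribution `ε L z` cancel, so that `z` drops out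
    -- of the linear coefficient `c₁`.
    have hsub : innerCForm h lam mu (strainXh h u - φ) (strainXh h z - ψ)
        = L z - innerCForm h lam mu (strainXh h u - φ) ψ := by rw [map_sub, hz']
    simp only [map_add, map_smul, LinearMap.add_apply, LinearMap.smul_apply, smul_eq_mul, hcomm,
      hcomm', hsub, c₁, c₂]
    ring
  rw [heq]
  have h2 := (((hasDerivAt_id (0 : ℝ)).const_mul c₁).add
    (((hasDerivAt_id (0 : ℝ)).pow 2).const_mul c₂)).const_add (energy lam mu alpha Ω ℓ u φ)
  simpa using h2

end Energy

/-! ### The time-stepping scheme -/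

/-- The evolution equation tested with `ψ ∈ Ψ_h`. -/
theorem innerPsiForm_evolution {T : Finset (Finset (Vec d))} {Ω : Set (Vec d)}
    (h : IsTriangulation T Ω) {lam mu alpha eta : ℝ} {u : XhSubmodule T Ω}
    {φ δ : PsihSubmodule T}
    (hev : ∀ᵐ x ∂(volume.restrict Ω),
      eta • δ.1 x + alpha • φ.1 x - stress lam mu u φ x = 0) (ψ : PsihSubmodule T) :
    eta * innerPsiForm h δ ψ + alpha * innerPsiForm h φ ψ =
      innerCForm h lam mu (strainXh h u - φ) ψ := by
  have h1 : innerPsiForm h (eta • δ + alpha • φ) ψ =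
      innerCForm h lam mu (strainXh h u - φ) ψ := by
    refine innerPsi_congr ?_ Filter.EventuallyEq.rfl
    filter_upwards [hev, strain_ae_eq_strainXh h u] with x hx hx'
    refine (sub_eq_zero.1 hx).trans ?_
    rw [stress, hx']
    rfl
  simpa using h1

/-- The change of the energy in one time step. -/
theorem energy_sub_energy {T : Finset (Finset (Vec d))} {Ω Γ₀ : Set (Vec d)}
    (h : IsTriangulation T Ω) {lam mu alpha eta τ : ℝ} (hC : TensorPositive d lam mu)
    {ℓ : (Vec d → Vec d) → ℝ} {L : XhSubmodule T Ω →ₗ[ℝ] ℝ}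
    (hL : ∀ v : XhSubmodule T Ω, L v = ℓ v) {u u' : XhSubmodule T Ω} {φ φ' : PsihSubmodule T}
    (hu : u - u' ∈ VhSubmodule T Ω Γ₀)
    (hbal : ∀ w ∈ VhSubmodule T Ω Γ₀,
      innerCForm h lam mu (strainXh h u - φ) (strainXh h w) = L w)
    (hev : ∀ᵐ x ∂(volume.restrict Ω),
      eta • (τ⁻¹ • (φ - φ')).1 x + alpha • φ.1 x - stress lam mu u φ x = 0) :
    energy lam mu alpha Ω ℓ u φ - energy lam mu alpha Ω ℓ u' φ' =
      -(eta * τ⁻¹ + alpha / 2) * innerPsiForm h (φ - φ') (φ - φ')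
        - 1 / 2 * innerCForm h lam mu ((strainXh h u - φ) - (strainXh h u' - φ'))
            ((strainXh h u - φ) - (strainXh h u' - φ')) := by
  -- The increment `u - u'` is an admissible test function because both displacements have the same
  -- boundary data.
  have h1 := hbal _ hu
  have h2 := innerPsiForm_evolution h hev (φ - φ')
  have h3 : strainXh h (u - u') =
      ((strainXh h u - φ) - (strainXh h u' - φ')) + (φ - φ') := by
    rw [map_sub]
    abel
  have h4 := innerCForm_comm h lam mu (strainXh h u - φ) (strainXh h u' - φ')
  have h5 : innerPsiForm h φ φ' = innerPsiForm h φ' φ := innerPsi_comm _ _ _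
  rw [h3] at h1
  rw [energy_eq h hC hL, energy_eq h hC hL]
  generalize strainXh h u - φ = x at *
  generalize strainXh h u' - φ' = y at *
  rw [map_add, ← h2, map_sub L] at h1
  simp only [map_sub, map_smul, LinearMap.sub_apply, LinearMap.smul_apply, smul_eq_mul] at h1 ⊢
  rw [h4, h5] at *
  -- With `x`, `y` the new and old elastic strains, this is `(‖x‖² - ‖y‖²) / 2 = (x, x - y) - ‖x -
  -- y‖² / 2` in the `C`-product, and its analogue for `φ`, `φ'`; the mixed terms cancel by `h1`.
  linarith

end MaxwellFEM

theorem theorem5 {d : ℕ} (hd : d = 2 ∨ d = 3)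
    -- geometry and mesh
    (Ω Γ₀ : Set (Vec d)) (hΩ : IsBoundedLipschitzDomain Ω) (hΓ₀ : IsDirichletPart Ω Γ₀)
    (Th : Finset (Finset (Vec d))) (hTh : IsTriangulation Th Ω)
    -- material constants, with a positive elasticity tensor
    (lam mu alpha eta : ℝ) (hC : TensorPositive d lam mu) (halpha : 0 ≤ alpha) (heta : 0 < eta)
    -- final time and time increment
    (tEnd τ : ℝ) (htEnd : 0 < tEnd) (hτ : 0 < τ)
    -- body force and traction, continuous in time, with vanishing time derivative
    (f : ℝ → L2vol Ω) (q : ℝ → L2surf (neumannPart Ω Γ₀))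
    (hf : ContinuousOn f (Set.Icc 0 tEnd)) (hq : ContinuousOn q (Set.Icc 0 tEnd))
    (hf' : ∀ t ∈ Set.Ioo 0 tEnd, HasDerivAt f 0 t)
    (hq' : ∀ t ∈ Set.Ioo 0 tEnd, HasDerivAt q 0 t)
    -- discrete boundary data (independent of the time step) and initial value
    (gh : Vec d → Vec d) (hgh : gh ∈ Xh Th Ω)
    (φ0 : Vec d → Mat d) (hφ0 : φ0 ∈ Psih Th)
    -- the solution of the scheme at the times `k * τ`, for `k ≤ ⌊tEnd / τ⌋`
    (u : ℕ → Vec d → Vec d) (φ : ℕ → Vec d → Mat d)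
    (hsol : IsSchemeSolution lam mu alpha eta τ ⌊tEnd / τ⌋₊ Th Ω Γ₀
      (fun k => load (f (k * τ)) (q (k * τ))) (fun _ => gh) φ0 u φ) :
    -- the minimum defining the reduced energy is attained
    (∀ ψ ∈ Psih Th,
      IsLeast (energyValues lam mu alpha Ω (load (f 0) (q 0)) (Vh Th Ω Γ₀ gh) ψ)
        (reducedEnergy lam mu alpha Ω (load (f 0) (q 0)) (Vh Th Ω Γ₀ gh) ψ)) ∧
    ∀ k : ℕ, 1 ≤ k → k ≤ ⌊tEnd / τ⌋₊ →
      -- gradient flow structure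
      (∀ ψ ∈ Psih Th,
        GateauxDifferentiableAt
          (reducedEnergy lam mu alpha Ω (load (f 0) (q 0)) (Vh Th Ω Γ₀ gh)) (φ k) ψ ∧
        innerPsi Ω (eta • bdiff τ φ k) ψ =
          -gateaux (reducedEnergy lam mu alpha Ω (load (f 0) (q 0)) (Vh Th Ω Γ₀ gh)) (φ k) ψ) ∧
      -- discrete energy identity
      (bdiff τ (fun j => energy lam mu alpha Ω (load (f 0) (q 0)) (u j) (φ j)) k
          + alpha * τ / 2 * normPsi Ω (bdiff τ φ k) ^ 2
          + τ / 2 * normC lam mu Ω (bdiff τ (fun j x => strain (u j) x - φ j x) k) ^ 2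
        = -eta * normPsi Ω (bdiff τ φ k) ^ 2) ∧
      -eta * normPsi Ω (bdiff τ φ k) ^ 2 ≤ 0 ∧
      -- energy decay
      energy lam mu alpha Ω (load (f 0) (q 0)) (u k) (φ k) ≤
        energy lam mu alpha Ω (load (f 0) (q 0)) (u (k - 1)) (φ (k - 1)) := by
  have hd1 : 1 ≤ d := by omega
  obtain ⟨L, hL⟩ := exists_load_linearMap hd1 hΩ Th (f 0) (q 0)
  set N := ⌊tEnd / τ⌋₊ with hN
  have hload : ∀ k ≤ N, load (f (k * τ)) (q (k * τ)) = load (f 0) (q 0) := by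
    intro k hk
    have hmem : (k : ℝ) * τ ∈ Icc 0 tEnd := by
      refine ⟨by positivity, (le_div_iff₀ hτ).1 ?_⟩
      exact (Nat.cast_le.2 hk).trans (Nat.floor_le (by positivity))
    rw [eq_of_hasDerivAt_zero_Ioo hf hf' hmem, eq_of_hasDerivAt_zero_Ioo hq hq' hmem]
  have hbal : ∀ (k : ℕ) (hk : k ≤ N), ∀ w ∈ VhSubmodule Th Ω Γ₀,
      innerCForm hTh lam mu (strainXh hTh ⟨u k, (hsol.mem_V k hk).1⟩ - ⟨φ k, hsol.mem_Psi k hk⟩)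
        (strainXh hTh w) = L w := by
    intro k hk w hw
    rw [← innerPsi_stress, hL, ← hload k hk]
    exact hsol.balance k hk w hw
  refine ⟨fun ψ hψ => ?_, fun k hk1 hk => ?_⟩
  · obtain ⟨z, -, hz⟩ := exists_isLeast_energyValues_line (alpha := alpha) hTh hC hL
      (hsol.mem_V 0 N.zero_le) ⟨φ 0, hsol.mem_Psi 0 N.zero_le⟩ (hbal 0 N.zero_le)
      -- The line through `φ 0` in direction `ψ - φ 0` reaches `ψ` at `ε = 1`; the balance at `k =
      -- 0` provides its starting equilibrium.
      (⟨ψ, hψ⟩ - ⟨φ 0, hsol.mem_Psi 0 N.zero_le⟩)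
    have h1 := hz 1
    rw [one_smul, one_smul, add_sub_cancel] at h1
    rw [reducedEnergy, h1.csInf_eq]
    exact h1
  have hk' : k - 1 ≤ N := by omega
  set U : XhSubmodule Th Ω := ⟨u k, (hsol.mem_V k hk).1⟩
  set U' : XhSubmodule Th Ω := ⟨u (k - 1), (hsol.mem_V (k - 1) hk').1⟩
  set P : PsihSubmodule Th := ⟨φ k, hsol.mem_Psi k hk⟩
  set P' : PsihSubmodule Th := ⟨φ (k - 1), hsol.mem_Psi (k - 1) hk'⟩
  have hev : ∀ᵐ x ∂(volume.restrict Ω),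
      eta • (τ⁻¹ • (P - P')).1 x + alpha • P.1 x - stress lam mu U P x = 0 :=
    hsol.evolution k hk1 hk
  have hPsi : normPsi Ω (bdiff τ φ k) ^ 2 = τ⁻¹ ^ 2 * innerPsiForm hTh (P - P') (P - P') := by
    rw [normPsi_sq]
    change innerPsiForm hTh (τ⁻¹ • (P - P')) (τ⁻¹ • (P - P')) = _
    simp only [map_smul, LinearMap.smul_apply, smul_eq_mul]
    ring
  have hCn : normC lam mu Ω (bdiff τ (fun j x => strain (u j) x - φ j x) k) ^ 2 =
      τ⁻¹ ^ 2 * innerCForm hTh lam mu ((strainXh hTh U - P) - (strainXh hTh U' - P'))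
        ((strainXh hTh U - P) - (strainXh hTh U' - P')) := by
    rw [normC_sq hTh hC (τ⁻¹ • ((strainXh hTh U - P) - (strainXh hTh U' - P')))]
    · simp only [map_smul, LinearMap.smul_apply, smul_eq_mul]
      ring
    · filter_upwards [strain_ae_eq_strainXh hTh U, strain_ae_eq_strainXh hTh U'] with x hx hx'
      change τ⁻¹ • ((strain U x - P.1 x) - (strain U' x - P'.1 x)) = _
      rw [hx, hx']
      rfl
  have hstep := energy_sub_energy hTh (alpha := alpha) hC hL
    (sub_mem_VhSubmodule (u := U) (v := U') (hsol.mem_V k hk) (hsol.mem_V (k - 1) hk'))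
    (hbal k hk) hev
  have hBn : 0 ≤ innerPsiForm hTh (P - P') (P - P') := innerPsi_self_nonneg _ _
  have hCn' := innerCForm_self_nonneg hTh hC ((strainXh hTh U - P) - (strainXh hTh U' - P'))
  refine ⟨fun ψ hψ => ?_, ?_, ?_, ?_⟩
  · have hder := hasDerivAt_reducedEnergy (alpha := alpha) hTh hC hL (hsol.mem_V k hk) P
      (hbal k hk) ⟨ψ, hψ⟩
    refine ⟨hder.differentiableAt, ?_⟩
    have h1 : gateaux (reducedEnergy lam mu alpha Ω (load (f 0) (q 0)) (Vh Th Ω Γ₀ gh)) (φ k) ψ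
        = _ := hder.deriv
    rw [h1, ← innerPsiForm_evolution hTh hev ⟨ψ, hψ⟩, innerPsi_smul_left]
    change eta * innerPsiForm hTh (τ⁻¹ • (P - P')) ⟨ψ, hψ⟩ = _
    ring
  · change τ⁻¹ • (energy lam mu alpha Ω (load (f 0) (q 0)) U P
      - energy lam mu alpha Ω (load (f 0) (q 0)) U' P') + _ + _ = _
    -- Increments are `τ` times difference quotients, so division by `τ` turns the factors `α/2` and
    -- `1/2` into `ατ/2` and `τ/2`, and `η/τ` into `η`.
    rw [hstep, hPsi, hCn, smul_eq_mul]
    field_simp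
    ring
  · have := mul_nonneg heta.le (sq_nonneg (normPsi Ω (bdiff τ φ k)))
    linarith
  · change energy lam mu alpha Ω (load (f 0) (q 0)) U P
      ≤ energy lam mu alpha Ω (load (f 0) (q 0)) U' P'
    have h1 : 0 ≤ (eta * τ⁻¹ + alpha / 2) * innerPsiForm hTh (P - P') (P - P') := by positivity
    linarith
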